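/- Let $\mathcal{D}$ be a triangulated category with translation functor $\Sigma$, and let $(\mathcal{D}^{\leq 0}, \mathcal{D}^{\geq 0})$ be a bounded $t$-structure on $\mathcal{D}$, that is, $\mathcal{D}=\bigcup_{i,j\in\mathbb{Z}}(\Sigma^i\mathcal{D}^{\leq 0}\cap\Sigma^j\mathcal{D}^{\geq 0})$. Let $\mathcal{A}=\mathcal{D}^{\leq 0}\cap\mathcal{D}^{\geq 0}$ be its heart, which is an abelian category, and let $\mathbf{D}^b(\mathcal{A})$ be the bounded derived category of $\mathcal{A}$, equipped with its canonical $t$-structure. View $\mathcal{A}$ as a full subcategory of $\mathbf{D}^b(\mathcal{A})$ through stalk complexes concentrated in degree zero. Let $F\colon \mathbf{D}^b(\mathcal{A})\to\mathcal{D}$ be a realization functor, that is, a triangle functor which is $t$-exact (it sends the heart of $\mathbf{D}^b(\mathcal{A})$ into $\mathcal{A}$) and whose restriction $F|_{\mathcal{A}}$ is, up to natural isomorphism, the identity functor of $\mathcal{A}$ (that is, its composite with the inclusion $\mathcal{A}\hookrightarrow\mathcal{D}$ is naturally isomorphic to this inclusion). If $F$ is dense (every object of $\mathcal{D}$ is isomorphic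 to $F(Z)$ for some $Z\in\mathbf{D}^b(\mathcal{A})$), then $F$ is an equivalence of categories. -/

import Mathlib

open CategoryTheory CategoryTheory.Limits CategoryTheory.Pretriangulated
  CategoryTheory.Triangulated

universe w v u v' u'

namespace RealizationFunctor

section Heart

variable {D : Type u} [Category.{v} D] [Preadditive D] [HasZeroObject D] [HasShift D ℤ]
  [∀ n : ℤ, (shiftFunctor D n).Additive] [Pretriangulated D] (t : TStructure D)

instance heart_containsZero : t.heart.ContainsZero where
  exists_zero :=
    ⟨_, isZero_zero D, (t.mem_heart_iff _).2
      ⟨t.isLE_of_isZero (isZero_zero D) 0, t.isGE_of_isZero (isZero_zero D) 0⟩⟩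

instance heart_isClosedUnderBinaryProducts : t.heart.IsClosedUnderBinaryProducts where
  limitsOfShape_le := by
    rintro X ⟨p⟩
    have h₁ := (t.mem_heart_iff _).1 (p.prop_diag_obj ⟨WalkingPair.left⟩)
    have h₂ := (t.mem_heart_iff _).1 (p.prop_diag_obj ⟨WalkingPair.right⟩)
    have hT := binaryProductTriangle_distinguished (p.diag.obj ⟨WalkingPair.left⟩)
      (p.diag.obj ⟨WalkingPair.right⟩)
    have h : t.heart (p.diag.obj ⟨WalkingPair.left⟩ ⨯ p.diag.obj ⟨WalkingPair.right⟩) :=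
      (t.mem_heart_iff _).2 ⟨t.isLE₂ _ hT 0 h₁.1 h₂.1, t.isGE₂ _ hT 0 h₁.2 h₂.2⟩
    exact t.heart.prop_of_iso
      (IsLimit.conePointsIsoOfNatIso (limit.isLimit _) p.isLimit
        (diagramIsoPair p.diag).symm) h

instance heart_isClosedUnderFiniteProducts : t.heart.IsClosedUnderFiniteProducts :=
  .mk'

lemma heart_hom_shift_eq_zero ⦃X Y : t.heart.FullSubcategory⦄ ⦃n : ℤ⦄
    (f : t.heart.ι.obj X ⟶ (t.heart.ι.obj Y)⟦n⟧) (hn : n < 0) : f = 0 := by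
  have hX : t.IsLE (t.heart.ι.obj X) 0 := ⟨X.property.1⟩
  have hY : t.IsGE (t.heart.ι.obj Y) 0 := ⟨Y.property.2⟩
  have hY' : t.IsGE ((t.heart.ι.obj Y)⟦n⟧) (-n) := t.isGE_shift _ 0 n (-n)
  exact t.zero f 0 (-n)

lemma heart_admissibleMorphism :
    AbelianSubcategory.admissibleMorphism t.heart.ι = ⊤ := by
  ext X₁ X₂ f₁
  refine ⟨fun _ ↦ trivial, fun _ ↦ ?_⟩
  intro X₃ f₂ f₃ hT
  have h₁ : t.IsLE (t.heart.ι.obj X₁) 0 := ⟨X₁.property.1⟩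
  have h₁' : t.IsGE (t.heart.ι.obj X₁) 0 := ⟨X₁.property.2⟩
  have h₂ : t.IsLE (t.heart.ι.obj X₂) 0 := ⟨X₂.property.1⟩
  have h₂' : t.IsGE (t.heart.ι.obj X₂) 0 := ⟨X₂.property.2⟩
  have hs : t.IsLE ((t.heart.ι.obj X₁)⟦(1 : ℤ)⟧) (-1) := t.isLE_shift _ 0 1 (-1)
  have hs' : t.IsGE ((t.heart.ι.obj X₁)⟦(1 : ℤ)⟧) (-1) := t.isGE_shift _ 0 1 (-1)
  have h₁s : t.IsLE ((t.heart.ι.obj X₁)⟦(1 : ℤ)⟧) 0 := t.isLE_of_le _ (-1) 0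
  have h₂s : t.IsGE (t.heart.ι.obj X₂) (-1) := t.isGE_of_ge _ (-1) 0
  have hT' := rot_of_distTriang _ hT
  have h₃ : t.IsLE X₃ 0 := t.isLE₂ _ hT' 0 h₂ h₁s
  have h₃' : t.IsGE X₃ (-1) := t.isGE₂ _ hT' (-1) h₂s hs'
  obtain ⟨K', Q, hK', hQ, α, β, γ, hT''⟩ := t.exists_triangle X₃ (-1) 0 (by lia)
  have hK'₁ : t.IsLE K' (-1) := ⟨hK'⟩
  have hQ₁ : t.IsGE Q 0 := ⟨hQ⟩
  have hKs : t.IsLE (K'⟦(1 : ℤ)⟧) (-2) := t.isLE_shift K' (-1) 1 (-2)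
  have hKs' : t.IsLE (K'⟦(1 : ℤ)⟧) 0 := t.isLE_of_le _ (-2) 0
  have hQs : t.IsGE (Q⟦(-1 : ℤ)⟧) 1 := t.isGE_shift Q 0 (-1) 1
  have hQs' : t.IsGE (Q⟦(-1 : ℤ)⟧) (-1) := t.isGE_of_ge _ (-1) 1
  have hQ₂ : t.IsLE Q 0 := t.isLE₂ _ (rot_of_distTriang _ hT'') 0 h₃ hKs'
  have hK'₂ : t.IsGE K' (-1) :=
    t.isGE₂ _ (inv_rot_of_distTriang _ hT'') (-1) hQs' h₃'
  let K : t.heart.FullSubcategory := ⟨K'⟦(-1 : ℤ)⟧, (t.mem_heart_iff _).2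
    ⟨t.isLE_shift K' (-1) (-1) 0, t.isGE_shift K' (-1) (-1) 0⟩⟩
  let e : (t.heart.ι.obj K)⟦(1 : ℤ)⟧ ≅ K' := (shiftEquiv D (1 : ℤ)).counitIso.app K'
  refine ⟨K, ⟨Q, (t.mem_heart_iff _).2 ⟨hQ₂, hQ₁⟩⟩, e.hom ≫ α, β, γ ≫ e.inv⟦(1 : ℤ)⟧', ?_⟩
  refine isomorphic_distinguished _ hT'' _ (Triangle.isoMk _ _ e (Iso.refl _) (Iso.refl _) ?_ ?_ ?_)
  · exact Category.comp_id _
  · exact (Category.comp_id _).trans (Category.id_comp _).symm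
  · change (γ ≫ e.inv⟦(1 : ℤ)⟧') ≫ e.hom⟦(1 : ℤ)⟧' = 𝟙 Q ≫ γ
    rw [Category.assoc, ← Functor.map_comp, e.inv_hom_id, CategoryTheory.Functor.map_id, Category.comp_id,
      Category.id_comp]

/-- The heart of a t-structure, i.e. the full subcategory of objects that are both
`≤ 0` and `≥ 0`, is an abelian category. -/
noncomputable instance heartAbelian [IsTriangulated D] : Abelian t.heart.FullSubcategory :=
  AbelianSubcategory.abelian t.heart.ι (heart_hom_shift_eq_zero t) (heart_admissibleMorphism t)

end Heart

section TExact

variable {C : Type u'} [Category.{v'} C] [Preadditive C] [HasZeroObject C] [HasShift C ℤ]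
  [∀ n : ℤ, (shiftFunctor C n).Additive] [Pretriangulated C]
  {D : Type u} [Category.{v} D] [Preadditive D] [HasZeroObject D] [HasShift D ℤ]
  [∀ n : ℤ, (shiftFunctor D n).Additive] [Pretriangulated D]

/-- A t-structure is bounded if every object lies between two integers
`a ≤ X ≤ b` for the t-structure. -/
def IsBounded (t : TStructure D) : Prop := ∀ X : D, t.bounded X

/-- A (triangle) functor between categories with bounded t-structures is t-exact
if it sends the heart to the heart. -/
def IsTExact (t : TStructure C) (t' : TStructure D) (F : C ⥤ D) : Prop :=
  ∀ X : C, t.heart X → t'.heart (F.obj X)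

end TExact

section BoundedDerivedCategory

variable (A : Type u) [Category.{v} A] [Abelian A] [HasDerivedCategory.{w} A]

/-- The canonical t-structure on `Dᵇ(A)`. -/
noncomputable abbrev tBounded : TStructure (DerivedCategory.Bounded A) :=
  (DerivedCategory.TStructure.t (C := A)).onBounded

/-- The functor `A ⥤ Dᵇ(A)` which sends an object to the corresponding stalk complex
concentrated in degree zero. -/
noncomputable def stalk : A ⥤ DerivedCategory.Bounded A :=
  DerivedCategory.TStructure.t.bounded.lift (DerivedCategory.singleFunctor A 0)
    (fun _ ↦ ⟨⟨0, inferInstance⟩, ⟨0, inferInstance⟩⟩)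

end BoundedDerivedCategory

section Realization

variable {D : Type u} [Category.{v} D] [Preadditive D] [HasZeroObject D] [HasShift D ℤ]
  [∀ n : ℤ, (shiftFunctor D n).Additive] [Pretriangulated D] [IsTriangulated D]

/-- Let `A` be the heart of a t-structure `t` on `D`. A functor `F : Dᵇ(A) ⥤ D`, equipped
with natural isomorphisms of commutation with the shifts, is a realization functor
if it is a triangle functor, is t-exact, and if its restriction to `A` (embedded in `Dᵇ(A)`
as stalk complexes) is the inclusion of the heart in `D`, up to a natural isomorphism. -/
structure IsRealizationFunctor (t : TStructure D)
    [HasDerivedCategory.{w} t.heart.FullSubcategory]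
    (F : DerivedCategory.Bounded t.heart.FullSubcategory ⥤ D) [F.CommShift ℤ] : Prop where
  isTriangulated : F.IsTriangulated
  isTExact : IsTExact (tBounded t.heart.FullSubcategory) t F
  restriction : Nonempty (stalk t.heart.FullSubcategory ⋙ F ≅ t.heart.ι)

end Realization

end RealizationFunctor

/-! Every object with bounded degrees is an iterated extension of objects concentrated in one
degree, so by the five lemma it is enough to compare Hom groups between such pure objects
(`devissage`, `MapBijective.ext_left`, `MapBijective.ext_right`). A map from degree `a` to degree
`b` is a class of degree `a - b`: for `a < b` both sides vanish, and for `a = b` the restriction of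
`F` to the heart is fully faithful.

For `b < a`, density gives fullness (`IsTExact.exists_lift_shift`). The class of a map `F X ⟶ (F
Y)⟦1⟧` is an extension whose middle term is some `F Z`. Since `F` reflects the degrees of the
t-structure, the extension can be recovered inside the source category.

Faithfulness is dimension shifting (`IsTExact.eq_zero_of_map_eq_zero`). In `Dᵇ(A)` every class of
positive degree is killed by an epimorphism of the heart (`isEffaceable_tBounded`), and fullness one
degree lower lets the induction run. -/

namespace RealizationFunctor

set_option linter.unusedSectionVars false

/-! ### Hom-bijectivity and its invariance under isomorphism and shift. -/

section MapBijective

variable {C : Type u'} [Category.{v'} C] {D : Type u} [Category.{v} D]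

/-- The functor `F` induces a bijection on morphisms from `X` to `Y`. -/
def MapBijective (F : C ⥤ D) (X Y : C) : Prop :=
  Function.Bijective (F.map : (X ⟶ Y) → (F.obj X ⟶ F.obj Y))

lemma MapBijective.of_iso {F : C ⥤ D} {X Y X' Y' : C} (h : MapBijective F X Y)
    (e : X ≅ X') (e' : Y ≅ Y') : MapBijective F X' Y' := by
  have eq : (F.map : (X' ⟶ Y') → _) ∘ (Iso.homCongr e e') =
      (Iso.homCongr (F.mapIso e) (F.mapIso e')) ∘ F.map := by
    ext f
    simp [Iso.homCongr]
  have := (Iso.homCongr (F.mapIso e) (F.mapIso e')).bijective.comp h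
  rw [← eq] at this
  exact (Function.Bijective.of_comp_iff _ (Iso.homCongr e e').bijective).1 this

lemma MapBijective.shift [HasShift C ℤ] [HasShift D ℤ] {F : C ⥤ D} [F.CommShift ℤ] {X Y : C}
    (h : MapBijective F X Y) (n : ℤ) : MapBijective F (X⟦n⟧) (Y⟦n⟧) := by
  let α := (F.commShiftIso n).symm.app X
  let β := (F.commShiftIso n).symm.app Y
  have eq : (F.map : (X⟦n⟧ ⟶ Y⟦n⟧) → _) ∘ (shiftFunctor C n).map =
      (Iso.homCongr α β) ∘ (shiftFunctor D n).map ∘ F.map := by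
    ext f
    simp [Iso.homCongr, α, β]
  have := (Iso.homCongr α β).bijective.comp
    ((Functor.FullyFaithful.ofFullyFaithful (shiftFunctor D n)).map_bijective _ _ |>.comp h)
  rw [← eq] at this
  exact (Function.Bijective.of_comp_iff _
    ((Functor.FullyFaithful.ofFullyFaithful (shiftFunctor C n)).map_bijective _ _)).1 this

end MapBijective

/-! ### Pure objects and dévissage along a t-structure. -/

section Devissage

variable {C : Type u'} [Category.{v'} C] [Preadditive C] [HasZeroObject C] [HasShift C ℤ]
  [∀ n : ℤ, (shiftFunctor C n).Additive] [Pretriangulated C]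

/-- The object `X` is concentrated in degree `n` for the t-structure `t`. -/
def IsPure (t : TStructure C) (n : ℤ) : ObjectProperty C :=
  fun X ↦ t.IsLE X n ∧ t.IsGE X n

lemma IsPure.of_iso {t : TStructure C} {n : ℤ} {X Y : C} (h : IsPure t n X) (e : X ≅ Y) :
    IsPure t n Y := by
  obtain ⟨_, _⟩ := h
  exact ⟨t.isLE_of_iso e n, t.isGE_of_iso e n⟩

lemma IsPure.shift {t : TStructure C} {n : ℤ} {X : C} (h : IsPure t n X) (a m : ℤ)
    (hm : a + m = n) : IsPure t m (X⟦a⟧) := by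
  obtain ⟨_, _⟩ := h
  exact ⟨t.isLE_shift X n a m hm, t.isGE_shift X n a m hm⟩

lemma IsPure.of_shift {t : TStructure C} {m : ℤ} {X : C} {a : ℤ} (h : IsPure t m (X⟦a⟧)) (n : ℤ)
    (hm : a + m = n) : IsPure t n X := by
  obtain ⟨_, _⟩ := h
  exact ⟨t.isLE_of_shift X n a m hm, t.isGE_of_shift X n a m hm⟩

lemma isPure_zero_iff (t : TStructure C) (X : C) : IsPure t 0 X ↔ t.heart X :=
  (t.mem_heart_iff X).symm

lemma exists_bounds {t : TStructure C} (ht : IsBounded t) (X : C) :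
    ∃ a b, a ≤ b ∧ t.IsGE X a ∧ t.IsLE X b := by
  obtain ⟨⟨a, _⟩, ⟨b, _⟩⟩ := ht X
  -- The two given bounds may come in the wrong order when `X` is zero.
  exact ⟨min a b, max a b, by lia, t.isGE_of_ge X _ a, t.isLE_of_le X b _⟩

/-- Truncation peels off the lowest degree: `U` is `≥ a` because it is an extension of `X` by
`V⟦-1⟧`, which lies in degrees `≥ a + 2`. -/
lemma exists_triangle_isPure (t : TStructure C) (X : C) (a b : ℤ) (hab : a < b)
    (ha : t.IsGE X a) (hb : t.IsLE X b) :
    ∃ (U V : C) (f : U ⟶ X) (g : X ⟶ V) (k : V ⟶ U⟦(1 : ℤ)⟧),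
      Triangle.mk f g k ∈ distTriang C ∧ IsPure t a U ∧ t.IsGE V (a + 1) ∧ t.IsLE V b := by
  obtain ⟨U, V, hU, hV, f, g, k, hT⟩ := t.exists_triangle X a (a + 1) rfl
  have hU : t.IsLE U a := ⟨hU⟩
  have hV : t.IsGE V (a + 1) := ⟨hV⟩
  have hVs : t.IsGE (V⟦(-1 : ℤ)⟧) (a + 2) := t.isGE_shift V (a + 1) (-1) (a + 2)
  have hVs' : t.IsGE (V⟦(-1 : ℤ)⟧) a := t.isGE_of_ge _ a (a + 2)
  have hU' : t.IsGE U a := t.isGE₂ _ (inv_rot_of_distTriang _ hT) a hVs' ha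
  have hUs : t.IsLE (U⟦(1 : ℤ)⟧) (a - 1) := t.isLE_shift U a 1 (a - 1)
  have hUs' : t.IsLE (U⟦(1 : ℤ)⟧) b := t.isLE_of_le _ (a - 1) _
  exact ⟨U, V, f, g, k, hT, ⟨hU, hU'⟩, hV, t.isLE₂ _ (rot_of_distTriang _ hT) _ hb hUs'⟩

/-- An object in the range `[a, b]` of a t-structure is obtained by successive extensions from
objects that are concentrated in one degree `i ∈ [a, b]`. -/
lemma devissage (t : TStructure C) (P : ObjectProperty C)
    (hP : ∀ T ∈ distTriang C, P T.obj₁ → P T.obj₃ → P T.obj₂) (a b : ℤ) (hab : a ≤ b)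
    (h : ∀ i, a ≤ i → i ≤ b → IsPure t i ≤ P) (X : C) (ha : t.IsGE X a) (hb : t.IsLE X b) :
    P X := by
  obtain ⟨n, rfl⟩ := Int.le.dest hab
  induction n generalizing a X with
  | zero => exact h a le_rfl (by simp) X ⟨by simpa using hb, ha⟩
  | succ n ih =>
    obtain ⟨U, V, f, g, k, hT, hU, hV, hV'⟩ := exists_triangle_isPure t X a _ (by lia) ha hb
    rw [show a + ((n + 1 : ℕ) : ℤ) = (a + 1) + n by push_cast; ring] at hV'
    exact hP _ hT (h a le_rfl (by lia) U hU)
      (ih (a + 1) V hV (by lia) (fun i hi hi' ↦ h i (by lia) (by lia)) hV')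

lemma devissage_of_isBounded {t : TStructure C} (ht : IsBounded t) (P : ObjectProperty C)
    (hP : ∀ T ∈ distTriang C, P T.obj₁ → P T.obj₃ → P T.obj₂)
    (h : ∀ i, IsPure t i ≤ P) (X : C) : P X := by
  obtain ⟨a, b, hab, ha, hb⟩ := exists_bounds ht X
  exact devissage t P hP a b hab (fun i _ _ ↦ h i) X ha hb

end Devissage

/-! ### t-exact functors preserve and reflect degrees. -/

section TExactFunctor

variable {C : Type u'} [Category.{v'} C] [Preadditive C] [HasZeroObject C] [HasShift C ℤ]
  [∀ n : ℤ, (shiftFunctor C n).Additive] [Pretriangulated C]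
  {D : Type u} [Category.{v} D] [Preadditive D] [HasZeroObject D] [HasShift D ℤ]
  [∀ n : ℤ, (shiftFunctor D n).Additive] [Pretriangulated D]
  {t : TStructure C} {t' : TStructure D} {F : C ⥤ D} [F.CommShift ℤ]

lemma IsTExact.isPure (hF : IsTExact t t' F) {X : C} {n : ℤ} (h : IsPure t n X) :
    IsPure t' n (F.obj X) :=
  (((isPure_zero_iff t' _).2 (hF _ ((isPure_zero_iff t _).1 (h.shift n 0 (by lia))))).of_iso
    ((F.commShiftIso n).app X)).of_shift n (by lia)

lemma MapBijective.of_isPure (hff : ∀ ⦃X Y : C⦄, t.heart X → t.heart Y → MapBijective F X Y)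
    {X Y : C} {n : ℤ} (hX : IsPure t n X) (hY : IsPure t n Y) : MapBijective F X Y :=
  ((hff ((isPure_zero_iff t _).1 (hX.shift n 0 (by lia)))
    ((isPure_zero_iff t _).1 (hY.shift n 0 (by lia)))).shift (-n)).of_iso
    ((shiftEquiv C n).unitIso.symm.app X) ((shiftEquiv C n).unitIso.symm.app Y)

variable [F.IsTriangulated]

lemma IsTExact.isLE (hF : IsTExact t t' F) (ht : IsBounded t) (X : C) (n : ℤ) (h : t.IsLE X n) :
    t'.IsLE (F.obj X) n := by
  obtain ⟨a, _, _, ha, _⟩ := exists_bounds ht X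
  refine devissage t (fun X ↦ t'.IsLE (F.obj X) n)
    (fun T hT h₁ h₃ ↦ t'.isLE₂ _ (F.map_distinguished T hT) n h₁ h₃) (min a n) n
    (by lia) (fun i _ hi Y hY ↦ ?_) X (t.isGE_of_ge X _ a) h
  have := (hF.isPure hY).1
  exact t'.isLE_of_le (F.obj Y) i n

lemma IsTExact.isGE (hF : IsTExact t t' F) (ht : IsBounded t) (X : C) (n : ℤ) (h : t.IsGE X n) :
    t'.IsGE (F.obj X) n := by
  obtain ⟨_, b, _, _, hb⟩ := exists_bounds ht X
  refine devissage t (fun X ↦ t'.IsGE (F.obj X) n)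
    (fun T hT h₁ h₃ ↦ t'.isGE₂ _ (F.map_distinguished T hT) n h₁ h₃) n (max b n)
    (by lia) (fun i hi _ Y hY ↦ ?_) X h (t.isLE_of_le X b _)
  have := (hF.isPure hY).2
  exact t'.isGE_of_ge (F.obj Y) n i

/-- Induction on the amplitude. If `F X = 0`, then `F V ≅ (F U)⟦1⟧` for the lowest piece `U` and the
remainder `V`. One side lies in degrees `≥ a + 1`, the other in degrees `≤ a - 1`, so both vanish.
-/
lemma IsTExact.isZero_of_isZero_obj (hF : IsTExact t t' F) (ht : IsBounded t)
    (hff : ∀ ⦃X Y : C⦄, t.heart X → t.heart Y → MapBijective F X Y) (X : C)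
    (hX : IsZero (F.obj X)) : IsZero X := by
  have pure {X : C} {n : ℤ} (h : IsPure t n X) (hX : IsZero (F.obj X)) : IsZero X := by
    rw [IsZero.iff_id_eq_zero]
    exact (MapBijective.of_isPure hff h h).1 (hX.eq_of_src _ _)
  obtain ⟨a, b, hab, ha, hb⟩ := exists_bounds ht X
  obtain ⟨n, rfl⟩ := Int.le.dest hab
  induction n generalizing a X with
  | zero => exact pure (n := a) ⟨by simpa using hb, ha⟩ hX
  | succ n ih =>
    obtain ⟨U, V, f, g, k, hT, hU, hV, hV'⟩ := exists_triangle_isPure t X a _ (by lia) ha hb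
    rw [show a + ((n + 1 : ℕ) : ℤ) = (a + 1) + n by push_cast; ring] at hV'
    have hT' := F.map_distinguished _ hT
    have : IsIso (F.mapTriangle.obj (Triangle.mk f g k)).mor₃ :=
      (Triangle.isZero₂_iff_isIso₃ _ hT').1 hX
    have h₁ : t'.IsLE (F.obj U) a := (hF.isPure hU).1
    have h₂ : t'.IsLE ((F.mapTriangle.obj (Triangle.mk f g k)).obj₁⟦(1 : ℤ)⟧) (a - 1) :=
      t'.isLE_shift (F.obj U) a 1 (a - 1)
    have h₃ : t'.IsLE (F.obj V) (a - 1) :=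
      t'.isLE_of_iso (asIso (F.mapTriangle.obj (Triangle.mk f g k)).mor₃).symm (a - 1)
    have h₄ : t'.IsGE (F.obj V) (a + 1) := hF.isGE ht V _ hV
    have hFV : IsZero (F.obj V) := t'.isZero _ (a - 1) (a + 1)
    exact Triangle.isZero₂_of_isZero₁₃ _ hT
      (pure hU (Triangle.isZero₁_of_isZero₂₃ _ hT' hX hFV)) (ih V hFV (a + 1) hV (by lia) hV')

/-- The upper truncation `V` has `F V` both `≤ n` and `≥ n + 1`, hence zero, and `F` detects zero
objects. -/
lemma IsTExact.isLE_of_isLE_obj (hF : IsTExact t t' F) (ht : IsBounded t)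
    (hff : ∀ ⦃X Y : C⦄, t.heart X → t.heart Y → MapBijective F X Y) (X : C) (n : ℤ)
    (h : t'.IsLE (F.obj X) n) : t.IsLE X n := by
  obtain ⟨U, V, hU, hV, f, g, k, hT⟩ := t.exists_triangle X n (n + 1) rfl
  have hFU : t'.IsLE (F.obj U) n := hF.isLE ht U n ⟨hU⟩
  have hFV : t'.IsGE (F.obj V) (n + 1) := hF.isGE ht V _ ⟨hV⟩
  have h₁ : t'.IsLE ((F.obj U)⟦(1 : ℤ)⟧) (n - 1) := t'.isLE_shift _ n 1 (n - 1)
  have h₂ : t'.IsLE ((F.obj U)⟦(1 : ℤ)⟧) n := t'.isLE_of_le _ (n - 1) n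
  have h₃ : t'.IsLE (F.obj V) n :=
    t'.isLE₂ _ (rot_of_distTriang _ (F.map_distinguished _ hT)) n h h₂
  exact t.isLE₂ _ hT n ⟨hU⟩
    (t.isLE_of_isZero (hF.isZero_of_isZero_obj ht hff V (t'.isZero _ n (n + 1))) n)

lemma IsTExact.isGE_of_isGE_obj (hF : IsTExact t t' F) (ht : IsBounded t)
    (hff : ∀ ⦃X Y : C⦄, t.heart X → t.heart Y → MapBijective F X Y) (X : C) (n : ℤ)
    (h : t'.IsGE (F.obj X) n) : t.IsGE X n := by
  obtain ⟨U, V, hU, hV, f, g, k, hT⟩ := t.exists_triangle X (n - 1) n (by lia)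
  have hFU : t'.IsLE (F.obj U) (n - 1) := hF.isLE ht U _ ⟨hU⟩
  have hFV : t'.IsGE (F.obj V) n := hF.isGE ht V _ ⟨hV⟩
  have h₁ : t'.IsGE ((F.obj V)⟦(-1 : ℤ)⟧) (n + 1) := t'.isGE_shift _ n (-1) (n + 1)
  have h₂ : t'.IsGE ((F.obj V)⟦(-1 : ℤ)⟧) n := t'.isGE_of_ge _ n (n + 1)
  have h₃ : t'.IsGE (F.obj U) n :=
    t'.isGE₂ _ (inv_rot_of_distTriang _ (F.map_distinguished _ hT)) n h₂ h
  exact t.isGE₂ _ hT n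
    (t.isGE_of_isZero (hF.isZero_of_isZero_obj ht hff U (t'.isZero _ (n - 1) n)) n) ⟨hV⟩

lemma IsTExact.isPure_of_isPure_obj (hF : IsTExact t t' F) (ht : IsBounded t)
    (hff : ∀ ⦃X Y : C⦄, t.heart X → t.heart Y → MapBijective F X Y) {X : C} {n : ℤ}
    (h : IsPure t' n (F.obj X)) : IsPure t n X :=
  ⟨hF.isLE_of_isLE_obj ht hff X n h.1, hF.isGE_of_isGE_obj ht hff X n h.2⟩

end TExactFunctor

/-! ### Exactness of Hom on a distinguished triangle, as lifting and descent statements. -/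

section Exactness

variable {C : Type u'} [Category.{v'} C] [Preadditive C] [HasZeroObject C] [HasShift C ℤ]
  [∀ n : ℤ, (shiftFunctor C n).Additive] [Pretriangulated C]
  {X Y Z : C} {f : X ⟶ Y} {g : Y ⟶ Z} {h : Z ⟶ X⟦(1 : ℤ)⟧}
  (hT : Triangle.mk f g h ∈ distTriang C)

include hT

lemma exists_desc₂ {W : C} (φ : Y ⟶ W) (hφ : f ≫ φ = 0) : ∃ ψ : Z ⟶ W, φ = g ≫ ψ :=
  Triangle.yoneda_exact₂ _ hT φ hφ

lemma exists_desc₃ {W : C} (φ : Z ⟶ W) (hφ : g ≫ φ = 0) : ∃ ψ : X⟦(1 : ℤ)⟧ ⟶ W, φ = h ≫ ψ :=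
  Triangle.yoneda_exact₃ _ hT φ hφ

lemma exists_desc_shift {W : C} (φ : X⟦(1 : ℤ)⟧ ⟶ W) (hφ : h ≫ φ = 0) :
    ∃ ψ : Y⟦(1 : ℤ)⟧ ⟶ W, φ = -f⟦(1 : ℤ)⟧' ≫ ψ := by
  obtain ⟨ψ, hψ⟩ := Triangle.yoneda_exact₃ _ (rot_of_distTriang _ hT) φ hφ
  exact ⟨ψ, hψ.trans (Preadditive.neg_comp _ _)⟩

lemma exists_desc₁ {W : C} (φ : X ⟶ W) (hφ : h ≫ φ⟦(1 : ℤ)⟧' = 0) : ∃ ψ : Y ⟶ W, φ = f ≫ ψ := by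
  obtain ⟨ψ, hψ⟩ := exists_desc_shift hT (φ⟦(1 : ℤ)⟧') hφ
  refine ⟨-(shiftFunctor C (1 : ℤ)).preimage ψ, (shiftFunctor C (1 : ℤ)).map_injective ?_⟩
  simp [hψ]

lemma exists_lift₂ {W : C} (φ : W ⟶ Y) (hφ : φ ≫ g = 0) : ∃ ψ : W ⟶ X, φ = ψ ≫ f :=
  Triangle.coyoneda_exact₂ _ hT φ hφ

lemma exists_lift₃ {W : C} (φ : W ⟶ Z) (hφ : φ ≫ h = 0) : ∃ ψ : W ⟶ Y, φ = ψ ≫ g :=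
  Triangle.coyoneda_exact₃ _ hT φ hφ

lemma exists_lift_shift {W : C} (φ : W ⟶ X⟦(1 : ℤ)⟧) (hφ : φ ≫ f⟦(1 : ℤ)⟧' = 0) :
    ∃ ψ : W ⟶ Z, φ = ψ ≫ h :=
  Triangle.coyoneda_exact₁ _ hT φ hφ

lemma mor_comp_mor₂₃ : g ≫ h = 0 := comp_distTriang_mor_zero₂₃ _ hT

lemma mor_comp_mor₃₁ : h ≫ f⟦(1 : ℤ)⟧' = 0 := comp_distTriang_mor_zero₃₁ _ hT

lemma map_mk_distinguished {D : Type u} [Category.{v} D] [Preadditive D] [HasZeroObject D]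
    [HasShift D ℤ] [∀ n : ℤ, (shiftFunctor D n).Additive] [Pretriangulated D]
    (F : C ⥤ D) [F.CommShift ℤ] [F.IsTriangulated] :
    Triangle.mk (F.map f) (F.map g) (F.map h ≫ (F.commShiftIso (1 : ℤ)).hom.app X) ∈
      distTriang D :=
  F.map_distinguished _ hT

end Exactness

/-! ### Fullness from density, faithfulness from effaceability. -/

section FullyFaithful

variable {C : Type u'} [Category.{v'} C] [Preadditive C] [HasZeroObject C] [HasShift C ℤ]
  [∀ n : ℤ, (shiftFunctor C n).Additive] [Pretriangulated C]
  {D : Type u} [Category.{v} D] [Preadditive D] [HasZeroObject D] [HasShift D ℤ]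
  [∀ n : ℤ, (shiftFunctor D n).Additive] [Pretriangulated D]
  {t : TStructure C} {t' : TStructure D} {F : C ⥤ D} [F.CommShift ℤ]

/-- Once `f` is compared with the image of some `δ` by maps between pure objects of equal degree,
those maps lift, and `δ` composed with the lifts is a preimage of `f`. -/
lemma exists_lift_of_isPure
    (hff : ∀ ⦃X Y : C⦄, t.heart X → t.heart Y → MapBijective F X Y)
    {X Y V W : C} {a b : ℤ} (hX : IsPure t a X) (hV : IsPure t a V) (hY : IsPure t b Y)
    (hW : IsPure t b W) (f : F.obj X ⟶ (F.obj Y)⟦(1 : ℤ)⟧) (δ : V ⟶ W⟦(1 : ℤ)⟧)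
    (u : F.obj W ⟶ F.obj Y) (e : F.obj V ≅ F.obj X)
    (fac : (F.map δ ≫ (F.commShiftIso (1 : ℤ)).hom.app W) ≫ u⟦(1 : ℤ)⟧' = e.hom ≫ f) :
    ∃ g : X ⟶ Y⟦(1 : ℤ)⟧, F.map g ≫ (F.commShiftIso (1 : ℤ)).hom.app Y = f := by
  obtain ⟨u, rfl⟩ := (MapBijective.of_isPure hff hW hY).2 u
  obtain ⟨s, hs⟩ := (MapBijective.of_isPure hff hX hV).2 e.inv
  refine ⟨s ≫ δ ≫ u⟦(1 : ℤ)⟧', ?_⟩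
  rw [← cancel_epi e.hom, ← fac]
  simp [hs]

variable [F.IsTriangulated]

lemma IsTExact.exists_lift_shift (hF : IsTExact t t' F) (ht : IsBounded t)
    (hff : ∀ ⦃X Y : C⦄, t.heart X → t.heart Y → MapBijective F X Y) [F.EssSurj]
    {X Y : C} {a b : ℤ} (hX : IsPure t a X) (hY : IsPure t b Y) (hab : b ≤ a)
    (f : F.obj X ⟶ (F.obj Y)⟦(1 : ℤ)⟧) :
    ∃ g : X ⟶ Y⟦(1 : ℤ)⟧, F.map g ≫ (F.commShiftIso (1 : ℤ)).hom.app Y = f := by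
  have hFX := hF.isPure hX
  have hFY := hF.isPure hY
  obtain ⟨E, α, β, hE⟩ := distinguished_cocone_triangle₂ f
  -- This is where density enters: the middle term of the extension comes from the source.
  let Z := F.objPreimage E
  let e : F.obj Z ≅ E := F.objObjPreimageIso E
  -- If `b < a`, the triangle on `E` is its truncation triangle at `b`, so uniqueness of truncations
  -- identifies it with the image of that of `Z`.
  obtain hab | rfl := hab.lt_or_eq
  · obtain ⟨W, V, hW, hV, p, q, δ, hT⟩ := t.exists_triangle Z b (b + 1) rfl
    have : t'.IsGE (F.obj X) a := hFX.2
    obtain ⟨θ, hθ⟩ := t'.triangle_iso_exists (F.map_distinguished _ hT) hE e b (b + 1)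
      (hF.isLE ht W b ⟨hW⟩) (hF.isGE ht V _ ⟨hV⟩) hFY.1 (t'.isGE_of_ge (F.obj X) (b + 1) a)
    let e₁ : F.obj W ≅ F.obj Y := Triangle.π₁.mapIso θ
    let e₃ : F.obj V ≅ F.obj X := Triangle.π₃.mapIso θ
    exact exists_lift_of_isPure hff hX (hF.isPure_of_isPure_obj ht hff (hFX.of_iso e₃.symm)) hY
      (hF.isPure_of_isPure_obj ht hff (hFY.of_iso e₁.symm)) f δ e₁.hom e₃ θ.hom.comm₃
  -- In equal degrees truncation does not split `E`. Instead `Z` is pure, so the projection `E ⟶ F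
  -- X` lifts to `p`, whose fibre `W` satisfies `F W ≅ F Y`.
  · have hE' : IsPure t' b E := ⟨t'.isLE₂ _ hE b hFY.1 hFX.1, t'.isGE₂ _ hE b hFY.2 hFX.2⟩
    have hZ : IsPure t b Z := hF.isPure_of_isPure_obj ht hff (hE'.of_iso e.symm)
    obtain ⟨p, hp⟩ := (MapBijective.of_isPure hff hZ hX).2 (e.hom ≫ β)
    obtain ⟨W, i, δ, hT⟩ := distinguished_cocone_triangle₁ p
    have hT' := map_mk_distinguished hT F
    have hp' : F.map p ≫ 𝟙 (F.obj X) = e.hom ≫ β := by rw [hp, Category.comp_id]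
    obtain ⟨u, hu₁, hu₃⟩ := complete_distinguished_triangle_morphism₁ _ _ hT' hE e.hom
      (𝟙 (F.obj X)) hp'
    let φ : Triangle.mk (F.map i) (F.map p) (F.map δ ≫ (F.commShiftIso (1 : ℤ)).hom.app W) ⟶
        Triangle.mk α β f :=
      { hom₁ := u
        hom₂ := e.hom
        hom₃ := 𝟙 (F.obj X)
        comm₁ := hu₁
        comm₂ := hp'
        comm₃ := hu₃ }
    have : IsIso u := isIso₁_of_isIso₂₃ φ hT' hE
      (inferInstanceAs (IsIso e.hom)) (inferInstanceAs (IsIso (𝟙 (F.obj X))))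
    let e₁ : F.obj W ≅ F.obj Y := @asIso _ _ _ _ u this
    exact exists_lift_of_isPure hff hX hX hY
      (hF.isPure_of_isPure_obj ht hff (hFY.of_iso e₁.symm)) f δ u (Iso.refl _) hu₃

lemma IsTExact.map_surjective_of_isPure (hF : IsTExact t t' F) (ht : IsBounded t)
    (hff : ∀ ⦃X Y : C⦄, t.heart X → t.heart Y → MapBijective F X Y) [F.EssSurj]
    {X Y : C} {a b : ℤ} (hX : IsPure t a X) (hY : IsPure t b Y) :
    Function.Surjective (F.map : (X ⟶ Y) → _) := by
  intro f
  obtain hab | rfl | hab := lt_trichotomy a b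
  · have := (hF.isPure hX).1
    have := (hF.isPure hY).2
    exact ⟨0, by rw [F.map_zero, t'.zero f a b]⟩
  · exact (MapBijective.of_isPure hff hX hY).2 f
  -- `Y⟦-1⟧` is pure of degree `b + 1 ≤ a`, exactly the range of `exists_lift_shift`.
  · let κ : (Y⟦(-1 : ℤ)⟧)⟦(1 : ℤ)⟧ ≅ Y := (shiftEquiv C (1 : ℤ)).counitIso.app Y
    obtain ⟨g, hg⟩ := hF.exists_lift_shift ht hff hX (hY.shift (-1) (b + 1) (by lia)) (by lia)
      (f ≫ F.map κ.inv ≫ (F.commShiftIso (1 : ℤ)).hom.app _)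
    refine ⟨g ≫ κ.hom, ?_⟩
    rw [← Category.assoc, cancel_mono] at hg
    rw [F.map_comp, hg, Category.assoc, ← F.map_comp, κ.inv_hom_id, F.map_id, Category.comp_id]

/-- Morphisms of positive degree between objects of the heart of the t-structure are killed by
suitable epimorphisms in the heart. -/
def IsEffaceable (t : TStructure C) : Prop :=
  ∀ ⦃X Y : C⦄ ⦃a b : ℤ⦄, b < a → IsPure t a X → IsPure t b Y → ∀ g : X ⟶ Y,
    ∃ (K X' : C) (i : K ⟶ X') (p : X' ⟶ X) (δ : X ⟶ K⟦(1 : ℤ)⟧),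
      Triangle.mk i p δ ∈ distTriang C ∧ IsPure t a K ∧ IsPure t a X' ∧ p ≫ g = 0

lemma IsTExact.eq_zero_of_map_eq_zero (hF : IsTExact t t' F) (ht : IsBounded t)
    (hff : ∀ ⦃X Y : C⦄, t.heart X → t.heart Y → MapBijective F X Y) [F.EssSurj]
    (heff : IsEffaceable t)
    {X Y : C} {a b : ℤ} (hX : IsPure t a X) (hY : IsPure t b Y) (g : X ⟶ Y)
    (hg : F.map g = 0) : g = 0 := by
  obtain hab | hab := lt_or_ge a b
  · have := hX.1
    have := hY.2
    exact t.zero g a b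
  obtain ⟨n, rfl⟩ := Int.le.dest hab
  induction n generalizing X with
  | zero =>
    rw [Nat.cast_zero, add_zero] at hX
    exact (MapBijective.of_isPure hff hX hY).1 (by rw [hg, F.map_zero])
  | succ n ih =>
    obtain ⟨K, X', i, p, δ, hT, hK, hX', hpg⟩ := heff (by lia) hX hY g
    have hK₁ : IsPure t (b + n) (K⟦(1 : ℤ)⟧) := hK.shift 1 _ (by push_cast; ring)
    have hX'₁ : IsPure t (b + n) (X'⟦(1 : ℤ)⟧) := hX'.shift 1 _ (by push_cast; ring)
    obtain ⟨h, rfl⟩ := exists_desc₃ hT g hpg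
    obtain ⟨u, hu⟩ := exists_desc_shift (map_mk_distinguished hT F)
      ((F.commShiftIso (1 : ℤ)).inv.app K ≫ F.map h) (by simpa using hg)
    obtain ⟨v, hv⟩ := hF.map_surjective_of_isPure ht hff hX'₁ hY
      ((F.commShiftIso (1 : ℤ)).hom.app X' ≫ u)
    -- `F.map h` need not vanish, but it comes from `X'⟦1⟧`; the lift `v` corrects `h` to a map
    -- killed by `F`. The source `K⟦1⟧` is one degree closer to `Y`, and the correction dies after
    -- composing with `δ`.
    have hh : h + i⟦(1 : ℤ)⟧' ≫ v = 0 := by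
      refine ih (hX := hK₁) _ ?_ (by lia)
      have hu' : F.map h = (F.commShiftIso (1 : ℤ)).hom.app K ≫ (-(F.map i)⟦(1 : ℤ)⟧') ≫ u := by
        rw [← cancel_epi ((F.commShiftIso (1 : ℤ)).inv.app K), hu]
        simp
      simp [hv, hu']
    rw [eq_neg_of_add_eq_zero_left hh, Preadditive.comp_neg, ← Category.assoc,
      mor_comp_mor₃₁ hT, zero_comp, neg_zero]

lemma IsTExact.mapBijective_of_isPure (hF : IsTExact t t' F) (ht : IsBounded t)
    (hff : ∀ ⦃X Y : C⦄, t.heart X → t.heart Y → MapBijective F X Y) [F.EssSurj]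
    (heff : IsEffaceable t)
    {X Y : C} {a b : ℤ} (hX : IsPure t a X) (hY : IsPure t b Y) : MapBijective F X Y := by
  refine ⟨fun g g' h ↦ ?_, hF.map_surjective_of_isPure ht hff hX hY⟩
  rw [← sub_eq_zero]
  exact hF.eq_zero_of_map_eq_zero ht hff heff hX hY _ (by rw [F.map_sub, h, sub_self])

lemma MapBijective.shift_left {X Y : C} {n m : ℤ} (hnm : n + m = 0)
    (h : MapBijective F X (Y⟦m⟧)) : MapBijective F (X⟦n⟧) Y :=
  (h.shift n).of_iso (Iso.refl _) ((shiftFunctorCompIsoId C m n (by lia)).app Y)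

/-- Five lemma for `Hom(-, Y)`. Injectivity uses surjectivity at `X₁⟦1⟧`; surjectivity uses
injectivity into `Y⟦1⟧`, which plays the role of `X₃⟦-1⟧`. -/
lemma MapBijective.ext_left {X₁ X₂ X₃ : C} {p : X₁ ⟶ X₂} {q : X₂ ⟶ X₃} {δ : X₃ ⟶ X₁⟦(1 : ℤ)⟧}
    (hT : Triangle.mk p q δ ∈ distTriang C) (Y : C)
    (h₁ : MapBijective F X₁ Y) (h₃ : MapBijective F X₃ Y)
    (h₁' : MapBijective F (X₁⟦(1 : ℤ)⟧) Y) (h₃' : MapBijective F X₃ (Y⟦(1 : ℤ)⟧)) :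
    MapBijective F X₂ Y := by
  have hT' := map_mk_distinguished hT F
  constructor
  · intro g g' hg
    rw [← sub_eq_zero, ← F.map_sub] at hg
    rw [← sub_eq_zero]
    generalize g - g' = g at hg ⊢
    obtain ⟨v, rfl⟩ := exists_desc₂ hT g
      (h₁.1 (by rw [F.map_comp, hg, comp_zero, F.map_zero]))
    obtain ⟨w, hw⟩ := exists_desc₃ hT' (F.map v) (by simpa using hg)
    obtain ⟨w', hw'⟩ := h₁'.2 ((F.commShiftIso (1 : ℤ)).hom.app _ ≫ w)
    have : v = δ ≫ w' := h₃.1 (by rw [F.map_comp, hw', hw, Category.assoc])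
    rw [this, ← Category.assoc, mor_comp_mor₂₃ hT, zero_comp]
  · intro f
    obtain ⟨g, hg⟩ := h₁.2 (F.map p ≫ f)
    have hg' : δ ≫ g⟦(1 : ℤ)⟧' = 0 := h₃'.1 (by
      have := mor_comp_mor₃₁ hT'
      rw [Category.assoc] at this
      rw [F.map_comp, F.map_zero, ← cancel_mono ((F.commShiftIso (1 : ℤ)).hom.app Y),
        Category.assoc, F.commShiftIso_hom_naturality, hg, Functor.map_comp,
        reassoc_of% this, zero_comp, zero_comp])
    obtain ⟨k, rfl⟩ := exists_desc₁ hT g hg'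
    obtain ⟨u, hu⟩ := exists_desc₂ hT' (f - F.map k) (by
      rw [Preadditive.comp_sub, ← F.map_comp, hg, sub_self])
    obtain ⟨v, rfl⟩ := h₃.2 u
    refine ⟨k + q ≫ v, ?_⟩
    rw [F.map_add, F.map_comp, ← hu, add_sub_cancel]

lemma MapBijective.ext_right {Y₁ Y₂ Y₃ : C} {p : Y₁ ⟶ Y₂} {q : Y₂ ⟶ Y₃} {δ : Y₃ ⟶ Y₁⟦(1 : ℤ)⟧}
    (hT : Triangle.mk p q δ ∈ distTriang C) (X : C)
    (h₁ : MapBijective F X Y₁) (h₃ : MapBijective F X Y₃)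
    (h₁' : MapBijective F X (Y₁⟦(1 : ℤ)⟧)) (h₃' : MapBijective F (X⟦(1 : ℤ)⟧) Y₃) :
    MapBijective F X Y₂ := by
  have hT' := map_mk_distinguished hT F
  constructor
  · intro g g' hg
    rw [← sub_eq_zero, ← F.map_sub] at hg
    rw [← sub_eq_zero]
    generalize g - g' = g at hg ⊢
    obtain ⟨v, rfl⟩ := exists_lift₂ hT g
      (h₃.1 (by rw [F.map_comp, hg, zero_comp, F.map_zero]))
    obtain ⟨w, hw⟩ := exists_lift_shift hT' ((F.map v)⟦(1 : ℤ)⟧') (by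
      rw [← Functor.map_comp, ← F.map_comp, hg, Functor.map_zero])
    obtain ⟨w', hw'⟩ := h₃'.2 ((F.commShiftIso (1 : ℤ)).hom.app X ≫ w)
    have : v⟦(1 : ℤ)⟧' = w' ≫ δ := (h₁.shift 1).1 (by
      rw [← cancel_mono ((F.commShiftIso (1 : ℤ)).hom.app Y₁), F.commShiftIso_hom_naturality, hw,
        F.map_comp, hw', Category.assoc, Category.assoc])
    apply (shiftFunctor C (1 : ℤ)).map_injective
    rw [Functor.map_comp, this, Category.assoc, mor_comp_mor₃₁ hT, comp_zero, Functor.map_zero]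
  · intro f
    obtain ⟨g, hg⟩ := h₃.2 (f ≫ F.map q)
    have hg' : g ≫ δ = 0 := h₁'.1 (by
      rw [F.map_comp, hg, Category.assoc, ← F.map_comp, mor_comp_mor₂₃ hT, F.map_zero, comp_zero,
        F.map_zero])
    obtain ⟨k, rfl⟩ := exists_lift₃ hT g hg'
    obtain ⟨u, hu⟩ := exists_lift₂ hT' (f - F.map k) (by
      rw [Preadditive.sub_comp, ← F.map_comp, hg, sub_self])
    obtain ⟨v, rfl⟩ := h₁.2 u
    refine ⟨k + v ≫ p, ?_⟩
    rw [F.map_add, F.map_comp, ← hu, add_sub_cancel]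

lemma IsTExact.mapBijective (hF : IsTExact t t' F) (ht : IsBounded t)
    (hff : ∀ ⦃X Y : C⦄, t.heart X → t.heart Y → MapBijective F X Y) [F.EssSurj]
    (heff : IsEffaceable t) (X Y : C) : MapBijective F X Y := by
  -- All degrees `b` are treated together because the five lemma involves shifts of `Y`.
  have h₁ (X : C) : ∀ (b : ℤ) (Y : C), IsPure t b Y → MapBijective F X Y := by
    refine devissage_of_isBounded ht
      (fun X ↦ ∀ (b : ℤ) (Y : C), IsPure t b Y → MapBijective F X Y) ?_ ?_ X
    · intro T hT h₁ h₃ b Y hY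
      exact .ext_left hT Y (h₁ b Y hY) (h₃ b Y hY)
        (.shift_left (by lia : (1 : ℤ) + (-1) = 0)
          (h₁ (b + 1) _ (hY.shift (-1) (b + 1) (by lia))))
        (h₃ (b - 1) _ (hY.shift 1 (b - 1) (by lia)))
    · exact fun a X hX b Y hY ↦ hF.mapBijective_of_isPure ht hff heff hX hY
  refine devissage_of_isBounded ht (fun Y ↦ ∀ X, MapBijective F X Y) ?_
    (fun b Y hY X ↦ h₁ X b Y hY) Y X
  intro T hT h₁ h₃ X
  refine .ext_right hT X (h₁ X) (h₃ X) ?_ (h₃ _)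
  exact ((h₁ (X⟦(-1 : ℤ)⟧)).shift 1).of_iso ((shiftEquiv C (1 : ℤ)).counitIso.app X) (Iso.refl _)

/-- A t-exact triangle functor which is fully faithful on hearts and dense is an equivalence, when
the t-structure on the source is bounded and effaceable. -/
theorem IsTExact.isEquivalence (hF : IsTExact t t' F) (ht : IsBounded t)
    (hff : ∀ ⦃X Y : C⦄, t.heart X → t.heart Y → MapBijective F X Y) [F.EssSurj]
    (heff : IsEffaceable t) : F.IsEquivalence where
  faithful := ⟨fun h ↦ (hF.mapBijective ht hff heff _ _).1 h⟩
  full := ⟨fun f ↦ (hF.mapBijective ht hff heff _ _).2 f⟩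

end FullyFaithful

/-! ### Killing positive-degree classes by means of complexes. -/

section Complexes

variable {A : Type u} [Category.{v} A] [Abelian A]

/-- Since `K` vanishes in degree 1, its degree zero term consists of cycles, which surject onto the
homology, that is, onto `X`. -/
lemma epi_f_of_quasiIso_single {K : CochainComplex A ℤ} {X : A} [K.IsStrictlyLE 0]
    (s : K ⟶ (HomologicalComplex.single A (ComplexShape.up ℤ) 0).obj X) [QuasiIso s] :
    Epi (s.f 0) := by
  let L := (HomologicalComplex.single A (ComplexShape.up ℤ) 0).obj X
  have : IsIso (L.homologyπ 0) := L.isIso_homologyπ (-1) 0 (by simp) (by simp [L])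
  have : IsIso (L.iCycles 0) := L.isIso_iCycles 0 1 (by simp) (by simp [L])
  have : IsIso (K.iCycles 0) := K.isIso_iCycles 0 1 (by simp)
    ((K.isZero_of_isStrictlyLE 0 1 (by lia)).eq_of_tgt _ _)
  have h : HomologicalComplex.cyclesMap s 0 ≫ L.homologyπ 0 =
      K.homologyπ 0 ≫ HomologicalComplex.homologyMap s 0 := by simp [L]
  have : Epi (HomologicalComplex.cyclesMap s 0 ≫ L.homologyπ 0) := by rw [h]; infer_instance
  have : Epi (HomologicalComplex.cyclesMap s 0) := by
    rw [show HomologicalComplex.cyclesMap s 0 =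
      (HomologicalComplex.cyclesMap s 0 ≫ L.homologyπ 0) ≫ inv (L.homologyπ 0) by simp]
    infer_instance
  have h' : K.iCycles 0 ≫ s.f 0 = HomologicalComplex.cyclesMap s 0 ≫ L.iCycles 0 := by simp [L]
  have : Epi (K.iCycles 0 ≫ s.f 0) := by rw [h']; infer_instance
  exact epi_of_epi (K.iCycles 0) (s.f 0)

/-- A quasi-isomorphism from a complex in nonpositive degrees to a stalk complex gives an
epimorphism from the stalk complex of its degree zero term. -/
lemma exists_epi_of_quasiIso_single {K : CochainComplex A ℤ} {X : A} [K.IsStrictlyLE 0]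
    (s : K ⟶ (HomologicalComplex.single A (ComplexShape.up ℤ) 0).obj X) [QuasiIso s] :
    ∃ (P : A) (j : (HomologicalComplex.single A (ComplexShape.up ℤ) 0).obj P ⟶ K) (φ : P ⟶ X),
      Epi φ ∧ (HomologicalComplex.single A (ComplexShape.up ℤ) 0).map φ = j ≫ s := by
  let j : (HomologicalComplex.single A (ComplexShape.up ℤ) 0).obj (K.X 0) ⟶ K :=
    HomologicalComplex.mkHomFromSingle (𝟙 (K.X 0)) (fun k hk ↦
      (K.isZero_of_isStrictlyLE 0 k (by simp at hk; lia)).eq_of_tgt _ _)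
  obtain ⟨φ, hφ⟩ := (HomologicalComplex.single A (ComplexShape.up ℤ) 0).map_surjective (j ≫ s)
  refine ⟨K.X 0, j, φ, ?_, hφ⟩
  have := epi_f_of_quasiIso_single s
  have h : φ = s.f 0 ≫ (HomologicalComplex.singleObjXSelf (ComplexShape.up ℤ) 0 X).hom := by
    have := HomologicalComplex.congr_hom hφ 0
    simp only [HomologicalComplex.single_map_f_self, HomologicalComplex.comp_f, j,
      HomologicalComplex.mkHomFromSingle_f, Category.comp_id] at this
    rw [cancel_epi] at this
    rw [← this, Category.assoc, Iso.inv_hom_id, Category.comp_id]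
  rw [h]
  infer_instance

variable [HasDerivedCategory.{w} A]

lemma exists_distinguished_triangle_of_epi {X : DerivedCategory A} {P X₀ : A} (φ : P ⟶ X₀) [Epi φ]
    (c : X ≅ (DerivedCategory.singleFunctor A 0).obj X₀) :
    ∃ (i : (DerivedCategory.singleFunctor A 0).obj (kernel φ) ⟶
        (DerivedCategory.singleFunctor A 0).obj P)
      (δ : X ⟶ ((DerivedCategory.singleFunctor A 0).obj (kernel φ))⟦(1 : ℤ)⟧),
      Triangle.mk i ((DerivedCategory.singleFunctor A 0).map φ ≫ c.inv) δ ∈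
        distTriang (DerivedCategory A) := by
  let S : ShortComplex A := ShortComplex.mk (kernel.ι φ) φ (kernel.condition φ)
  have hS : S.ShortExact :=
    { exact := S.exact_of_f_is_kernel (kernelIsKernel φ)
      mono_f := inferInstanceAs (Mono (kernel.ι φ))
      epi_g := inferInstanceAs (Epi φ) }
  refine ⟨(DerivedCategory.singleFunctor A 0).map (kernel.ι φ), c.hom ≫ hS.singleδ,
    isomorphic_distinguished _ hS.singleTriangle_distinguished _ ?_⟩
  refine Triangle.isoMk _ _ (Iso.refl _) (Iso.refl _) c ?_ ?_ ?_
  · exact (Category.comp_id _).trans (Category.id_comp _).symm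
  · change ((DerivedCategory.singleFunctor A 0).map φ ≫ c.inv) ≫ c.hom =
      𝟙 _ ≫ (DerivedCategory.singleFunctor A 0).map φ
    simp
  · change (c.hom ≫ hS.singleδ) ≫ (𝟙 _)⟦(1 : ℤ)⟧' = c.hom ≫ hS.singleδ
    simp

lemma exists_triangle_comp_eq_zero {X Y : DerivedCategory A} {b : ℤ} (hb : b < 0)
    (hX : IsPure DerivedCategory.TStructure.t 0 X) (hY : Y.IsLE b) (g : X ⟶ Y) :
    ∃ (K P : A) (i : (DerivedCategory.singleFunctor A 0).obj K ⟶
        (DerivedCategory.singleFunctor A 0).obj P)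
      (p : (DerivedCategory.singleFunctor A 0).obj P ⟶ X)
      (δ : X ⟶ ((DerivedCategory.singleFunctor A 0).obj K)⟦(1 : ℤ)⟧),
      Triangle.mk i p δ ∈ distTriang (DerivedCategory A) ∧ p ≫ g = 0 := by
  obtain ⟨_, _⟩ := hX
  obtain ⟨X₀, ⟨c⟩⟩ := X.exists_iso_singleFunctor_obj_of_isGE_of_isLE 0
  obtain ⟨L, _, ⟨e⟩⟩ := Y.exists_iso_Q_obj_of_isLE b
  let M := (HomologicalComplex.single A (ComplexShape.up ℤ) 0).obj X₀
  let c' : X ≅ DerivedCategory.Q.obj M := c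
  -- The map is a right fraction whose roof `K` lives in degrees `≤ 0`. The degree zero term of `K`
  -- is the required cover of `X`: it maps to `L`, which is zero in degree 0 because `b < 0`.
  obtain ⟨K, _, s, hs, g', hg'⟩ :=
    DerivedCategory.right_fac_of_isStrictlyLE (c'.inv ≫ g ≫ e.hom) 0
  have : QuasiIso s := (DerivedCategory.isIso_Q_map_iff_quasiIso _ s).1 hs
  obtain ⟨P, j, φ, _, hφ⟩ := exists_epi_of_quasiIso_single s
  obtain ⟨i, δ, hT⟩ := exists_distinguished_triangle_of_epi φ c
  refine ⟨_, P, i, _, δ, hT, ?_⟩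
  have hj : j ≫ g' = 0 :=
    HomologicalComplex.from_single_hom_ext
      ((L.isZero_of_isStrictlyLE b 0 hb).eq_of_tgt _ _)
  have hQ : (DerivedCategory.singleFunctor A 0).map φ =
      DerivedCategory.Q.map j ≫ DerivedCategory.Q.map s := by
    rw [← Functor.map_comp, ← hφ]
    rfl
  rw [← cancel_mono e.hom, zero_comp, hQ]
  change (((DerivedCategory.Q.map j ≫ DerivedCategory.Q.map s) ≫ c'.inv) ≫ g) ≫ e.hom = 0
  trans DerivedCategory.Q.map j ≫ DerivedCategory.Q.map s ≫ (c'.inv ≫ g ≫ e.hom)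
  · simp only [Category.assoc]
  · rw [hg', IsIso.hom_inv_id_assoc, ← Functor.map_comp, hj, Functor.map_zero]

end Complexes

/-! ### Effaceability of the canonical t-structure on the bounded derived category. -/

section Effaceability

variable {C : Type u'} [Category.{v'} C] [Preadditive C] [HasZeroObject C] [HasShift C ℤ]
  [∀ n : ℤ, (shiftFunctor C n).Additive] [Pretriangulated C]

lemma isEffaceable_of_isPure_zero (t : TStructure C)
    (h : ∀ ⦃X Y : C⦄ ⦃b : ℤ⦄, b < 0 → IsPure t 0 X → IsPure t b Y → ∀ g : X ⟶ Y,
      ∃ (K X' : C) (i : K ⟶ X') (p : X' ⟶ X) (δ : X ⟶ K⟦(1 : ℤ)⟧),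
        Triangle.mk i p δ ∈ distTriang C ∧ IsPure t 0 K ∧ IsPure t 0 X' ∧ p ≫ g = 0) :
    IsEffaceable t := by
  intro X Y a b hab hX hY g
  obtain ⟨K, X', i, p, δ, hT, hK, hX', hpg⟩ := h (b := b - a) (by lia) (hX.shift a 0 (by lia))
    (hY.shift a (b - a) (by lia)) (g⟦a⟧')
  have hT' := Triangle.shift_distinguished _ hT (-a)
  let κ (Z : C) : Z⟦a⟧⟦-a⟧ ≅ Z := (shiftEquiv C a).unitIso.symm.app Z
  -- The signs are those of the shifted triangle; they do not affect the vanishing of the composite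
  -- with `g`.
  refine ⟨K⟦-a⟧, X'⟦-a⟧, (-a).negOnePow • i⟦-a⟧', ((-a).negOnePow • p⟦-a⟧') ≫ (κ X).hom,
    (κ X).inv ≫ ((-a).negOnePow • δ⟦-a⟧' ≫ (shiftFunctorComm C 1 (-a)).hom.app K),
    isomorphic_distinguished _ hT' _ ?_, hK.shift (-a) a (by lia), hX'.shift (-a) a (by lia), ?_⟩
  · refine Triangle.isoMk _ _ (Iso.refl _) (Iso.refl _) ((κ X).symm) ?_ ?_ ?_
    · exact (Category.comp_id _).trans (Category.id_comp _).symm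
    · change (((-a).negOnePow • p⟦-a⟧') ≫ (κ X).hom) ≫ (κ X).inv =
        𝟙 _ ≫ ((-a).negOnePow • p⟦-a⟧')
      rw [Category.assoc, Iso.hom_inv_id, Category.id_comp, Category.comp_id]
    · refine (congrArg _ ((shiftFunctor C (1 : ℤ)).map_id _)).trans ?_
      exact Category.comp_id _
  · have hκ : (κ X).hom ≫ g = (g⟦a⟧')⟦-a⟧' ≫ (κ Y).hom := ((shiftEquiv C a).unitIso.symm.hom.naturality g).symm
    rw [Category.assoc, hκ, ← Category.assoc, Linear.units_smul_comp, ← Functor.map_comp, hpg,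
      Functor.map_zero, smul_zero, zero_comp]

variable (A : Type u) [Category.{v} A] [Abelian A] [HasDerivedCategory.{w} A]

lemma isBounded_tBounded : IsBounded (tBounded A) := by
  rintro ⟨X, ⟨a, ha⟩, ⟨b, hb⟩⟩
  exact ⟨⟨a, ⟨ha.1⟩⟩, ⟨b, ⟨hb.1⟩⟩⟩

lemma isPure_stalk (X : A) : IsPure (tBounded A) 0 ((stalk A).obj X) :=
  ⟨⟨(inferInstance : ((DerivedCategory.singleFunctor A 0).obj X).IsLE 0).1⟩,
    ⟨(inferInstance : ((DerivedCategory.singleFunctor A 0).obj X).IsGE 0).1⟩⟩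

lemma isEffaceable_tBounded : IsEffaceable (tBounded A) := by
  refine isEffaceable_of_isPure_zero _ (fun X Y b hb hX hY g ↦ ?_)
  let ι : DerivedCategory.Bounded A ⥤ DerivedCategory A := DerivedCategory.Bounded.ι
  let hι : ι.FullyFaithful := ObjectProperty.fullyFaithfulι _
  obtain ⟨K, P, i, p, δ, hT, hpg⟩ := exists_triangle_comp_eq_zero hb
    (X := X.obj) (Y := Y.obj) ⟨⟨hX.1.1⟩, ⟨hX.2.1⟩⟩ ⟨hY.1.1⟩ (ι.map g)
  let p' : ι.obj ((stalk A).obj P) ⟶ ι.obj X := p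
  have hpg' : p' ≫ ι.map g = 0 := hpg
  refine ⟨(stalk A).obj K, (stalk A).obj P, hι.preimage i, hι.preimage p',
    hι.preimage (δ ≫ (ι.commShiftIso (1 : ℤ)).inv.app ((stalk A).obj K)), ?_,
    isPure_stalk A K, isPure_stalk A P, ?_⟩
  · refine (ι.map_distinguished_iff _).1 (isomorphic_distinguished _ hT _
      (Triangle.isoMk _ _ (Iso.refl _) (Iso.refl _) (Iso.refl _) ?_ ?_ ?_))
    · exact (Category.comp_id _).trans (Category.id_comp _).symm
    · exact (Category.comp_id _).trans (Category.id_comp _).symm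
    · refine (congrArg _ ((shiftFunctor _ (1 : ℤ)).map_id _)).trans ?_
      refine (Category.comp_id _).trans (Eq.trans ?_ (Category.id_comp _).symm)
      change ι.map (hι.preimage (δ ≫ (ι.commShiftIso (1 : ℤ)).inv.app ((stalk A).obj K))) ≫
        (ι.commShiftIso (1 : ℤ)).hom.app ((stalk A).obj K) = δ
      rw [hι.map_preimage]
      refine (Category.assoc _ _ _).trans ?_
      exact (congrArg (δ ≫ ·) ((ι.commShiftIso (1 : ℤ)).inv_hom_id_app ((stalk A).obj K))).trans
        (Category.comp_id _)
  · apply hι.map_injective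
    rw [Functor.map_comp, hι.map_preimage, hpg', ι.map_zero]

variable {A} in
lemma exists_iso_stalk {X : DerivedCategory.Bounded A} (hX : (tBounded A).heart X) :
    ∃ X₀ : A, Nonempty ((stalk A).obj X₀ ≅ X) := by
  have h₁ : X.obj.IsLE 0 := ⟨hX.1⟩
  have h₂ : X.obj.IsGE 0 := ⟨hX.2⟩
  obtain ⟨X₀, ⟨e⟩⟩ := X.obj.exists_iso_singleFunctor_obj_of_isGE_of_isLE 0
  exact ⟨X₀, ⟨(ObjectProperty.fullyFaithfulι _).preimageIso e.symm⟩⟩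

instance : (stalk A).Full := 
  Functor.Full.of_comp_faithful_iso (G := DerivedCategory.Bounded.ι)
    (H := DerivedCategory.singleFunctor A 0) (Iso.refl _)

instance : (stalk A).Faithful :=
  Functor.Faithful.of_comp_iso (G := DerivedCategory.Bounded.ι)
    (H := DerivedCategory.singleFunctor A 0) (Iso.refl _)

end Effaceability

/-! ### Realization functors are fully faithful on the heart. -/

section Realization

variable {D : Type u} [Category.{v} D] [Preadditive D] [HasZeroObject D] [HasShift D ℤ]
  [∀ n : ℤ, (shiftFunctor D n).Additive] [Pretriangulated D] [IsTriangulated D]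

/-- Both `stalk` and `stalk ⋙ F`, the latter isomorphic to the inclusion of the heart, are fully
faithful, and every object of the canonical heart is a stalk. -/
lemma IsRealizationFunctor.mapBijective {t : TStructure D}
    [HasDerivedCategory.{w} t.heart.FullSubcategory]
    {F : DerivedCategory.Bounded t.heart.FullSubcategory ⥤ D} [F.CommShift ℤ]
    (hF : IsRealizationFunctor t F) ⦃X Y : DerivedCategory.Bounded t.heart.FullSubcategory⦄
    (hX : (tBounded t.heart.FullSubcategory).heart X)
    (hY : (tBounded t.heart.FullSubcategory).heart Y) : MapBijective F X Y := by
  obtain ⟨X₀, ⟨eX⟩⟩ := exists_iso_stalk hX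
  obtain ⟨Y₀, ⟨eY⟩⟩ := exists_iso_stalk hY
  refine MapBijective.of_iso ?_ eX eY
  obtain ⟨e⟩ := hF.restriction
  have h := ((t.heart.fullyFaithfulι).ofIso e.symm).map_bijective X₀ Y₀
  exact (Function.Bijective.of_comp_iff _
    ((Functor.FullyFaithful.ofFullyFaithful (stalk t.heart.FullSubcategory)).map_bijective
      X₀ Y₀)).1 h

end Realization

end RealizationFunctor

theorem theorem2p9 {D : Type u} [Category.{v} D] [Preadditive D] [HasZeroObject D]
    [HasShift D ℤ] [∀ n : ℤ, (shiftFunctor D n).Additive] [Pretriangulated D]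
    [IsTriangulated D] (t : TStructure D) (ht : RealizationFunctor.IsBounded t)
    [HasDerivedCategory.{w} t.heart.FullSubcategory]
    (F : DerivedCategory.Bounded t.heart.FullSubcategory ⥤ D) [F.CommShift ℤ]
    (hF : RealizationFunctor.IsRealizationFunctor t F)
    (hdense : F.EssSurj) :
    F.IsEquivalence := by
  have := hF.isTriangulated
  exact hF.isTExact.isEquivalence (RealizationFunctor.isBounded_tBounded _) hF.mapBijective
    (RealizationFunctor.isEffaceable_tBounded _)
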